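/- **Conventions.** For infinite cardinals $\nu,\lambda$ let $S_\nu(\lambda)=\{x\subseteq\lambda : |x|<\nu\}$. A set $X\subseteq S_\nu(\lambda)$ is cofinal if every $x\in S_\nu(\lambda)$ is contained in some $y\in X$, and $\operatorname{cf}S_\nu(\lambda)$ is the least cardinality of a cofinal $X\subseteq S_\nu(\lambda)$. An ultrafilter over $\lambda$ is uniform if all its members have cardinality $\lambda$; an ultrafilter $D$ over $I$ is $\mu$-decomposable if there is $f:I\to\mu$ such that the image ultrafilter $f(D)$ is uniform over $\mu$. **The relation $\lambda\stackrel{\kappa}{\Rightarrow}\mu$.** Let $\lambda\ge\mu$ be infinite cardinals and $\kappa\ge\sup\{\operatorname{cf}S_\lambda(\lambda),\operatorname{cf}S_\mu(\mu)\}$. Then $\lambda\stackrel{\kappa}{\Rightarrow}\mu$ means: for some cofinal sets $V\subseteq S_\lambda(\lambda)$, $W\subseteq S_\mu(\mu)$ of cardinality $\le\kappa$, the first-order model $\mathfrak A'=\langle\lambda,R,R_v\rangle_{v\in V\cup W}$, where $R(\gamma)$ iff $\gamma<\mu$ and $R_v(\gamma)$ iff $\gamma\in v$, has an expansion $\mathfrak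 A$ by at most $\kappa$ new symbols such that, whenever $\mathfrak B$ is an elementary extension of $\mathfrak A$ having an element $x$ with $\mathfrak B\models\neg R_v(x)$ for all $v\in V$, then $\mathfrak B$ has an element $y$ with $\mathfrak B\models R(y)$ and $\mathfrak B\models\neg R_w(y)$ for all $w\in W$. **Regular logics.** A logic $\mathcal L$ assigns to every (one-sorted) vocabulary $\tau$ a class $\mathcal L[\tau]$ of sentences, with a satisfaction relation between nonempty $\tau$-structures and sentences in $\mathcal L[\tau]$ which is invariant under isomorphism and under inclusion and renaming of vocabularies (if $i:\sigma\to\tau$ is an arity-preserving injection, then for each $\varphi\in\mathcal L[\sigma]$ there is $\psi\in\mathcal L[\tau]$ such that a $\tau$-structure satisfies $\psi$ iff its $\sigma$-reduct along $i$ satisfies $\varphi$). It is regular if it contains all atomic first-order sentences, is closed under negation, conjunction and particularization (for $\varphi\in\mathcal L[\tau\cup\{c\}]$, with $c\notin\tau$ a constant symbol, some $\psi\in\mathcal L[\tau]$ holds in $\mathfrak A$ iff $(\mathfrak A,a)\models\varphi$ for some $a\in A$), and permits relativization (for $\sigma\subseteq\tau$, $\varphi\in\mathcal L[\sigma]$ and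 $\chi\in\mathcal L[\tau\cup\{c\}]$ there is $\psi\in\mathcal L[\tau]$ such that, for every $\tau$-structure $\mathfrak A$ in which $U=\{a:(\mathfrak A,a)\models\chi\}$ is nonempty and closed under the constants and functions of $\sigma$, $\mathfrak A\models\psi$ iff the substructure of $\mathfrak A|_\sigma$ with domain $U$ satisfies $\varphi$) and substitution (if to every relation symbol of $\sigma$, and to the graph of every function or constant symbol of $\sigma$, there is assigned an $\mathcal L$-formula over $\tau$ of the right number of arguments, then for each $\varphi\in\mathcal L[\sigma]$ there is $\psi\in\mathcal L[\tau]$ such that, for every $\tau$-structure $\mathfrak A$ in which the formulas assigned to function and constant symbols define graphs of total functions, $\mathfrak A\models\psi$ iff the $\sigma$-structure on $A$ defined by these formulas satisfies $\varphi$). **Compactness.** Let $V\subseteq S_\lambda(\lambda)$ be cofinal, and consider the following condition on a set $\Sigma$ of sentences of $\mathcal L$ and a family $(\varphi_v)_{v\in V}$ of sentences of $\mathcal L$: if $\Sigma\cup\{\varphi_v : v\in V,\ \gamma\notin v\}$ has a model for every $\gamma\in\lambda$, then $\Sigma\cup\{\varphi_v : v\in V\}$ has a model. If $|V|\le\kappa$,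 the logic $\mathcal L$ is $\kappa$-$(\lambda)$-compact (relative to $V$) if the condition holds for all $(\varphi_v)_{v\in V}$ and all sets $\Sigma$ with $|\Sigma|\le\kappa$; it is $[\lambda]$-compact (relative to $V$) if it holds for all $(\varphi_v)_{v\in V}$ and all sets $\Sigma$, without any bound on $|\Sigma|$ (nor on $|V|$). **Proposition.** Let $\lambda\ge\mu$ be infinite cardinals and $\kappa\ge\sup\{\operatorname{cf}S_\lambda(\lambda),\operatorname{cf}S_\mu(\mu)\}$. 1. If $\lambda\stackrel{\kappa}{\Rightarrow}\mu$, then every $\kappa$-$(\lambda)$-compact regular logic is $\kappa$-$(\mu)$-compact, whatever cofinal sets of cardinality $\le\kappa$ are used for the two compactness properties. 2. If every ultrafilter uniform over $\lambda$ is $\mu$-decomposable, then every $[\lambda]$-compact regular logic is $[\mu]$-compact, whatever cofinal sets are used. -/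

import Mathlib

open FirstOrder Cardinal

universe u w

/-- `S_ν(λ)`: the subsets of (the underlying set of) the cardinal `λ` of cardinality `< ν`. -/
def SmallSubsets (ν lam : Cardinal.{u}) : Set (Set lam.ord.ToType) :=
  {x | #x < ν}

/-- `X` is a cofinal subset of `S_ν(λ)`. -/
def CofinalInSmall (ν lam : Cardinal.{u}) (X : Set (Set lam.ord.ToType)) : Prop :=
  X ⊆ SmallSubsets ν lam ∧ ∀ x ∈ SmallSubsets ν lam, ∃ y ∈ X, x ⊆ y

/-- `cf S_ν(λ)`: the least cardinality of a cofinal subset of `S_ν(λ)`. -/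
noncomputable def cfSmall (ν lam : Cardinal.{u}) : Cardinal.{u} :=
  sInf {c | ∃ X : Set (Set lam.ord.ToType), CofinalInSmall ν lam X ∧ #X = c}

/-- An ultrafilter over `λ` is uniform if all its members have cardinality `λ`. -/
def UniformOver (lam : Cardinal.{u}) (D : Ultrafilter lam.ord.ToType) : Prop :=
  ∀ s ∈ D, #s = lam

/-- An ultrafilter over `I` is `μ`-decomposable if some `f : I → μ` maps it to an ultrafilter
uniform over `μ`. -/
def Decomposable {I : Type u} (mu : Cardinal.{u}) (D : Ultrafilter I) : Prop :=
  ∃ f : I → mu.ord.ToType, UniformOver mu (D.map f)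

/-! ### The relation `λ ⇒^κ μ` -/

/-- The unary relation symbols `R` and `R_v` (`v ∈ I`). -/
inductive BaseRel (I : Type u) : ℕ → Type u
  | R : BaseRel I 1
  | mem (v : I) : BaseRel I 1

/-- The language `{R} ∪ {R_v : v ∈ I}`. -/
def baseLang (I : Type u) : FirstOrder.Language.{u, u} :=
  ⟨fun _ => PEmpty, BaseRel I⟩

/-- The inclusion of `μ` into `λ ≥ μ`, as sets of ordinals. -/
noncomputable def inclOrd {lam mu : Cardinal.{u}} (h : mu ≤ lam) (α : mu.ord.ToType) :
    lam.ord.ToType :=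
  Ordinal.ToType.mk ⟨α.toOrd.1, (Set.mem_Iio.1 α.toOrd.2).trans_le (ord_le_ord.2 h)⟩

/-- The copy inside `λ ≥ μ` of a family of subsets of `μ`. -/
noncomputable def inLarger {lam mu : Cardinal.{u}} (h : mu ≤ lam)
    (W : Set (Set mu.ord.ToType)) : Set (Set lam.ord.ToType) :=
  (fun w => inclOrd h '' w) '' W

/-- The model `𝔄' = ⟨λ, R, R_v⟩_{v ∈ I}`: `R` is the initial segment `μ` of `λ`, and `R_v` is `v`. -/
@[reducible] noncomputable def baseStructure {lam mu : Cardinal.{u}} (h : mu ≤ lam)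
    (I : Set (Set lam.ord.ToType)) : (baseLang I).Structure lam.ord.ToType where
  funMap f := f.elim
  RelMap r := match r with
    | .R => fun x => x 0 ∈ Set.range (inclOrd h)
    | .mem v => fun x => x 0 ∈ v.1

/-- The expansion `(𝔄', N)` of `𝔄'` by the interpretation `S` of a language `N` of new symbols is
such that every elementary extension `𝔅` with an element outside all `R_v` (`v ∈ V`) has an
element in `R` outside all `R_w` (`w ∈ W`). -/
def ExpansionWitnesses {lam mu : Cardinal.{u}} (h : mu ≤ lam)
    (V : Set (Set lam.ord.ToType)) (W : Set (Set mu.ord.ToType))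
    (N : FirstOrder.Language.{u, u}) (S : N.Structure lam.ord.ToType) : Prop :=
  letI := baseStructure h (V ∪ inLarger h W)
  letI := S
  ∀ (B : Type u) [((baseLang ↥(V ∪ inLarger h W)).sum N).Structure B],
    Nonempty (lam.ord.ToType ↪ₑ[(baseLang ↥(V ∪ inLarger h W)).sum N] B) →
    let R : B → Prop := fun b =>
      FirstOrder.Language.Structure.RelMap (L := (baseLang ↥(V ∪ inLarger h W)).sum N)
        (Sum.inl BaseRel.R) ![b]
    let Rmem : ↥(V ∪ inLarger h W) → B → Prop := fun v b =>
      FirstOrder.Language.Structure.RelMap (L := (baseLang ↥(V ∪ inLarger h W)).sum N)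
        (Sum.inl (BaseRel.mem v)) ![b]
    (∃ x : B, ∀ v, v.1 ∈ V → ¬ Rmem v x) →
      ∃ y : B, R y ∧ ∀ v, v.1 ∈ inLarger h W → ¬ Rmem v y

/-- `λ ⇒^κ μ`: for some cofinal `V ⊆ S_λ(λ)` and `W ⊆ S_μ(μ)` of cardinality `≤ κ`, the model `𝔄'`
has an expansion by at most `κ` new symbols as in `ExpansionWitnesses`. -/
def ModelImplies (κ lam mu : Cardinal.{u}) (h : mu ≤ lam) : Prop :=
  ∃ (V : Set (Set lam.ord.ToType)) (W : Set (Set mu.ord.ToType)),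
    CofinalInSmall lam lam V ∧ #V ≤ κ ∧ CofinalInSmall mu mu W ∧ #W ≤ κ ∧
    ∃ (N : FirstOrder.Language.{u, u}) (S : N.Structure lam.ord.ToType),
      N.card ≤ κ ∧ ExpansionWitnesses h V W N S

/-! ### Abstract logics -/

/-- An abstract logic: sentences for each vocabulary, and a satisfaction relation between nonempty
structures and sentences, with the isomorphism property and the reduct and renaming properties
(the latter two combined: `σ` is included in or renamed into `τ` by an injective language map). The
sentences of a vocabulary may form a proper class, hence the separate universe `w`. -/
structure AbstractLogic where
  Sentence : FirstOrder.Language.{u, u} → Type w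
  Sat : ∀ {τ : FirstOrder.Language.{u, u}} (M : Type u) [τ.Structure M] [Nonempty M], Sentence τ → Prop
  sat_iso : ∀ {τ : FirstOrder.Language.{u, u}} (M N : Type u) [τ.Structure M] [Nonempty M]
    [τ.Structure N] [Nonempty N], Nonempty (M ≃[τ] N) →
    ∀ φ : Sentence τ, Sat M φ ↔ Sat N φ
  exists_rename : ∀ {σ τ : FirstOrder.Language.{u, u}} (i : σ →ᴸ τ), i.Injective → ∀ φ : Sentence σ,
    ∃ ψ : Sentence τ, ∀ (M : Type u) [τ.Structure M] [Nonempty M],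
      Sat M ψ ↔ (letI := i.reduct M; Sat M φ)

namespace AbstractLogic

variable (L : AbstractLogic.{u, w})

/-- `(M, a₁, …, aₙ) ⊨ χ`, where `χ` is a sentence of the vocabulary with `n` new constants. -/
def SatAt {τ : FirstOrder.Language.{u, u}} (M : Type u) [τ.Structure M] [Nonempty M] {n : ℕ}
    (χ : L.Sentence (τ[[Fin n]])) (a : Fin n → M) : Prop :=
  letI := FirstOrder.Language.constantsOn.structure a
  L.Sat M χ

/-- A logic is regular if it has the atom, negation, conjunction, particularization,
relativization and substitution properties. -/
structure IsRegular : Prop where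
  atom : ∀ {τ : FirstOrder.Language.{u, u}} (θ : τ.Sentence), θ.IsAtomic →
    ∃ ψ : L.Sentence τ, ∀ (M : Type u) [τ.Structure M] [Nonempty M], L.Sat M ψ ↔ M ⊨ θ
  neg : ∀ {τ : FirstOrder.Language.{u, u}} (φ : L.Sentence τ),
    ∃ ψ : L.Sentence τ, ∀ (M : Type u) [τ.Structure M] [Nonempty M], L.Sat M ψ ↔ ¬ L.Sat M φ
  conj : ∀ {τ : FirstOrder.Language.{u, u}} (φ₁ φ₂ : L.Sentence τ),
    ∃ ψ : L.Sentence τ, ∀ (M : Type u) [τ.Structure M] [Nonempty M],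
      L.Sat M ψ ↔ L.Sat M φ₁ ∧ L.Sat M φ₂
  particularization : ∀ {τ : FirstOrder.Language.{u, u}} (φ : L.Sentence (τ[[Fin 1]])),
    ∃ ψ : L.Sentence τ, ∀ (M : Type u) [τ.Structure M] [Nonempty M],
      L.Sat M ψ ↔ ∃ a : M, L.SatAt M φ ![a]
  /-- `ψ` says that `φ` holds in the substructure defined by `χ`, whenever `χ` defines a nonempty
  set closed under the operations in the vocabulary `σ` of `φ`. -/
  relativization : ∀ {σ τ : FirstOrder.Language.{u, u}} (i : σ →ᴸ τ), i.Injective →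
    ∀ (φ : L.Sentence σ) (χ : L.Sentence (τ[[Fin 1]])),
    ∃ ψ : L.Sentence τ, ∀ (M : Type u) [τ.Structure M] [Nonempty M],
      letI := i.reduct M
      ∀ (U : σ.Substructure M) [Nonempty U], (∀ a : M, a ∈ U ↔ L.SatAt M χ ![a]) →
        (L.Sat M ψ ↔ L.Sat U φ)
  /-- The symbols of `σ` may be replaced by formulas over `τ`: `ψ` says that `φ` holds in the
  `σ`-structure whose relations, and whose graphs of operations, are defined by these formulas,
  whenever the formulas for the operations do define graphs of operations. -/
  substitution : ∀ {σ τ : FirstOrder.Language.{u, u}} (χR : ∀ n, σ.Relations n → L.Sentence (τ[[Fin n]]))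
    (χF : ∀ n, σ.Functions n → L.Sentence (τ[[Fin (n + 1)]])) (φ : L.Sentence σ),
    ∃ ψ : L.Sentence τ, ∀ (M : Type u) [τ.Structure M] [Nonempty M] [σ.Structure M],
      (∀ (n : ℕ) (r : σ.Relations n) (x : Fin n → M),
        FirstOrder.Language.Structure.RelMap r x ↔ L.SatAt M (χR n r) x) →
      (∀ (n : ℕ) (f : σ.Functions n) (x : Fin n → M) (y : M),
        FirstOrder.Language.Structure.funMap f x = y ↔ L.SatAt M (χF n f) (Fin.snoc x y)) →
      (L.Sat M ψ ↔ L.Sat M φ)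

/-- The set `Γ` of sentences has a model. -/
def HasModel {τ : FirstOrder.Language.{u, u}} (Γ : Set (L.Sentence τ)) : Prop :=
  ∃ (M : Type u) (_ : τ.Structure M) (_ : Nonempty M), ∀ φ ∈ Γ, L.Sat M φ

/-- The conclusion of `λ`-compactness, relative to `V`, for one set `Γ` and one family `φ`: if
`Γ ∪ {φ_v : γ ∉ v}` has a model for every `γ ∈ λ`, then `Γ ∪ {φ_v : v ∈ V}` has a model. -/
def CompactFor {τ : FirstOrder.Language.{u, u}} {lam : Cardinal.{u}} (V : Set (Set lam.ord.ToType))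
    (Γ : Set (L.Sentence τ)) (φ : V → L.Sentence τ) : Prop :=
  (∀ γ : lam.ord.ToType, L.HasModel (Γ ∪ {θ | ∃ v : V, γ ∉ v.1 ∧ φ v = θ})) →
    L.HasModel (Γ ∪ Set.range φ)

/-- `κ`-`(λ)`-compactness, relative to the fixed cofinal set `V`. -/
def KCompact (κ : Cardinal.{u}) {lam : Cardinal.{u}} (V : Set (Set lam.ord.ToType)) : Prop :=
  ∀ (τ : FirstOrder.Language.{u, u}) (Γ : Set (L.Sentence τ)) (φ : V → L.Sentence τ),
    lift.{u} #Γ ≤ lift.{w} κ → L.CompactFor V Γ φ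

/-- `[λ]`-compactness, relative to the fixed cofinal set `V`: `Γ` may be any set of sentences
(as opposed to a proper class). -/
def BoxCompact {lam : Cardinal.{u}} (V : Set (Set lam.ord.ToType)) : Prop :=
  ∀ (τ : FirstOrder.Language.{u, u}) (Γ : Set (L.Sentence τ)) (φ : V → L.Sentence τ),
    Small.{u} Γ → L.CompactFor V Γ φ

end AbstractLogic

/-! Part 1. Let `Γ` and `ψ_w` (`w ∈ W`) be given such that for each `γ < μ` some structure satisfies
`Γ` and every `ψ_w` with `γ ∉ w`. Over each element `a` of the expansion `𝔄` on `λ` hang such a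
structure as a fiber: the one for `γ = a` if `a < μ`, an arbitrary one of them otherwise. The
resulting bundle, one structure on the disjoint union of `𝔄` and the fibers, satisfies sentences of
the logic saying that the base satisfies the elementary diagram of `𝔄`, that every fiber satisfies
`Γ`, and that the fiber over a point of `R` outside `w` satisfies `ψ_w`. These are at most `κ`
sentences, and a distinguished base point may be put outside any prescribed sets omitting some `c ∈
λ`. By `κ`-`(λ)`-compactness there is a model whose distinguished point lies outside every `v ∈ V`.
Its base is an elementary extension of `𝔄`, so `λ ⇒^κ μ` yields a point `y` of `R` outside every
`w`, and the fiber over `y` satisfies `Γ` and all `ψ_w`. This is `familyCompact_of_expansion`.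
Different cofinal sets are reconciled by choosing, for each member of one, a superset in the other.

Part 2. Name all subsets and all self-maps of `λ`. An element `x` of an elementary extension that
avoids all small sets determines a uniform ultrafilter, the sets whose names hold of `x`. If `f`
decomposes it, the value at `x` of the symbol for `f` lies in `R` and avoids all small subsets of
`μ` (`expansionWitnesses_full`). Hence `λ ⇒^κ μ` for all large `κ`, and `[λ]`-compactness is
`κ`-`(λ)`-compactness for all large `κ`.

The regularity axioms enter through `exists_interpretation` and `exists_fiber`, which let the logic
speak about a fiber of the bundle. -/

open FirstOrder.Language FirstOrder.Language.Structure

/-! ### Definability in a regular logic -/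

/-- The language map sending the constants indexed by `α` to given constants of another language. -/
def FirstOrder.Language.LHom.ofConstants {α : Type*} {τ : FirstOrder.Language}
    (f : α → τ.Constants) : constantsOn α →ᴸ τ where
  onFunction := fun {n} c =>
    match n, c with
    | 0, c => f c
  onRelation := fun {_} r => r.elim

namespace AbstractLogic

variable {L : AbstractLogic.{u, w}}

/-- The `n`-ary predicate `P` on `τ`-structures is defined by a formula of the logic `L`. -/
def Definable (L : AbstractLogic.{u, w}) (τ : FirstOrder.Language.{u, u}) (n : ℕ)
    (P : ∀ (M : Type u) [τ.Structure M] [Nonempty M], (Fin n → M) → Prop) : Prop :=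
  ∃ χ : L.Sentence (τ[[Fin n]]), ∀ (M : Type u) [τ.Structure M] [Nonempty M] (a : Fin n → M),
    L.SatAt M χ a ↔ P M a

namespace Definable

variable {τ : FirstOrder.Language.{u, u}} {n : ℕ}
  {P Q : ∀ (M : Type u) [τ.Structure M] [Nonempty M], (Fin n → M) → Prop}

theorem congr (h : L.Definable τ n P)
    (hPQ : ∀ (M : Type u) [τ.Structure M] [Nonempty M] (a : Fin n → M), P M a ↔ Q M a) :
    L.Definable τ n Q := by
  obtain ⟨χ, hχ⟩ := h
  exact ⟨χ, fun M _ _ a => (hχ M a).trans (hPQ M a)⟩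

theorem satAt (χ : L.Sentence (τ[[Fin n]])) : L.Definable τ n fun M _ _ a => L.SatAt M χ a :=
  ⟨χ, fun _ _ _ _ => Iff.rfl⟩

theorem not (hL : L.IsRegular) (h : L.Definable τ n P) :
    L.Definable τ n fun M _ _ a => ¬ P M a := by
  obtain ⟨χ, hχ⟩ := h
  obtain ⟨ψ, hψ⟩ := hL.neg χ
  refine ⟨ψ, fun M _ _ a => ?_⟩
  let := constantsOn.structure a
  exact (hψ M).trans (not_congr (hχ M a))

theorem and (hL : L.IsRegular) (hP : L.Definable τ n P) (hQ : L.Definable τ n Q) :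
    L.Definable τ n fun M _ _ a => P M a ∧ Q M a := by
  obtain ⟨χ, hχ⟩ := hP
  obtain ⟨χ', hχ'⟩ := hQ
  obtain ⟨ψ, hψ⟩ := hL.conj χ χ'
  refine ⟨ψ, fun M _ _ a => ?_⟩
  let := constantsOn.structure a
  exact (hψ M).trans (and_congr (hχ M a) (hχ' M a))

theorem imp (hL : L.IsRegular) (hP : L.Definable τ n P) (hQ : L.Definable τ n Q) :
    L.Definable τ n fun M _ _ a => P M a → Q M a :=
  ((hP.and hL (hQ.not hL)).not hL).congr fun _ _ _ _ => by tauto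

theorem or (hL : L.IsRegular) (hP : L.Definable τ n P) (hQ : L.Definable τ n Q) :
    L.Definable τ n fun M _ _ a => P M a ∨ Q M a :=
  (((hP.not hL).and hL (hQ.not hL)).not hL).congr fun _ _ _ _ => by tauto

/-- A term with variables among the first `n`, as a closed term with `n` new constants. -/
def closedTerm (t : τ.Term (Empty ⊕ Fin n)) : (τ[[Fin n]]).Term (Empty ⊕ Fin 0) :=
  ((τ.lhomWithConstants (Fin n)).onTerm t).subst
    (Sum.elim Empty.elim fun i => (τ.con i).term)

theorem realize_closedTerm (M : Type u) [τ.Structure M] (a : Fin n → M)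
    (t : τ.Term (Empty ⊕ Fin n)) (v : Empty → M) (x : Fin 0 → M) :
    letI := constantsOn.structure a
    (closedTerm t).realize (Sum.elim v x) = t.realize (Sum.elim v a) := by
  let := constantsOn.structure a
  have h : (fun i => ((Sum.elim Empty.elim fun i => (τ.con i).term :
      Empty ⊕ Fin n → (τ[[Fin n]]).Term (Empty ⊕ Fin 0)) i).realize (Sum.elim v x)) =
      Sum.elim v a := by
    funext i
    rcases i with i | i
    · exact i.elim
    · simp only [Sum.elim_inr]
      exact Term.realize_constants
  rw [closedTerm, Term.realize_subst, h]
  exact LHom.realize_onTerm (τ.lhomWithConstants (Fin n)) t _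

theorem eq (hL : L.IsRegular) (s t : τ.Term (Empty ⊕ Fin n)) :
    L.Definable τ n fun _ _ _ a =>
      s.realize (Sum.elim Empty.elim a) = t.realize (Sum.elim Empty.elim a) := by
  obtain ⟨ψ, hψ⟩ := hL.atom ((closedTerm s).bdEqual (closedTerm t))
    (BoundedFormula.IsAtomic.equal _ _)
  refine ⟨ψ, fun M _ _ a => ?_⟩
  let := constantsOn.structure a
  refine (hψ M).trans ?_
  refine BoundedFormula.realize_bdEqual _ _ |>.trans ?_
  rw [realize_closedTerm M a, realize_closedTerm M a,
    Subsingleton.elim (default : Empty → M) Empty.elim]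

theorem rel (hL : L.IsRegular) {k : ℕ} (r : τ.Relations k)
    (ts : Fin k → τ.Term (Empty ⊕ Fin n)) :
    L.Definable τ n fun _ _ _ a =>
      RelMap r fun i => (ts i).realize (Sum.elim Empty.elim a) := by
  obtain ⟨ψ, hψ⟩ := hL.atom
    (Relations.boundedFormula (L := τ[[Fin n]]) (Sum.inl r) fun i => closedTerm (ts i))
    (BoundedFormula.IsAtomic.rel _ _)
  refine ⟨ψ, fun M _ _ a => ?_⟩
  let := constantsOn.structure a
  refine (hψ M).trans ?_
  refine BoundedFormula.realize_rel.trans ?_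
  simp only [realize_closedTerm M a, Subsingleton.elim (default : Empty → M) Empty.elim]
  exact Iff.rfl

end Definable

/-- Sentences may be transferred along any language map. -/
theorem IsRegular.exists_transfer (hL : L.IsRegular) {σ τ : FirstOrder.Language.{u, u}}
    (i : σ →ᴸ τ) (φ : L.Sentence σ) :
    ∃ ψ : L.Sentence τ, ∀ (M : Type u) [σ.Structure M] [τ.Structure M] [Nonempty M],
      i.IsExpansionOn M → (L.Sat M ψ ↔ L.Sat M φ) := by
  -- Each symbol is substituted by the atomic formula of its image, so injectivity of `i` plays no
  -- role.
  choose χR hχR using fun (n : ℕ) (r : σ.Relations n) =>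
    Definable.rel hL (i.onRelation r) fun j => (Term.var (Sum.inr j) : τ.Term (Empty ⊕ Fin n))
  choose χF hχF using fun (n : ℕ) (f : σ.Functions n) =>
    Definable.eq hL (Term.func (i.onFunction f) fun j =>
      (Term.var (Sum.inr j.castSucc) : τ.Term (Empty ⊕ Fin (n + 1)))) (Term.var (Sum.inr (Fin.last n)))
  obtain ⟨ψ, hψ⟩ := hL.substitution χR χF φ
  refine ⟨ψ, fun M _ _ _ hi => hψ M (fun n r x => ?_) fun n f x y => ?_⟩
  · rw [hχR]
    exact (Iff.of_eq (i.map_onRelation r x)).symm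
  · rw [hχF]
    simp only [Term.realize, Sum.elim_inr, Fin.snoc_castSucc, Fin.snoc_last]
    rw [i.map_onFunction]

namespace Definable

variable {τ : FirstOrder.Language.{u, u}} {n : ℕ}

/-- Particularization quantifies over a single constant added to a vocabulary. The `n + 1` constants
are therefore split into `n` that belong to the vocabulary and the last one, by transfer along a
language map. -/
theorem ex (hL : L.IsRegular)
    {P : ∀ (M : Type u) [τ.Structure M] [Nonempty M], (Fin (n + 1) → M) → Prop}
    (h : L.Definable τ (n + 1) P) :
    L.Definable τ n fun M _ _ a => ∃ b : M, P M (Fin.snoc a b) := by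
  obtain ⟨χ, hχ⟩ := h
  let c : Fin (n + 1) → ((τ[[Fin n]])[[Fin 1]]).Constants :=
    Fin.snoc (α := fun _ => ((τ[[Fin n]])[[Fin 1]]).Constants)
      (fun j => Sum.inl (τ.con j)) ((τ[[Fin n]]).con 0)
  let i : τ[[Fin (n + 1)]] →ᴸ (τ[[Fin n]])[[Fin 1]] :=
    LHom.sumElim (((τ[[Fin n]]).lhomWithConstants (Fin 1)).comp (τ.lhomWithConstants (Fin n)))
      (LHom.ofConstants c)
  obtain ⟨χ', hχ'⟩ := hL.exists_transfer i χ
  obtain ⟨ψ, hψ⟩ := hL.particularization χ'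
  refine ⟨ψ, fun M _ _ a => ?_⟩
  let := constantsOn.structure a
  refine (hψ M).trans (exists_congr fun b => ?_)
  rw [← hχ]
  let : (constantsOn (Fin 1)).Structure M := constantsOn.structure ![b]
  let : (constantsOn (Fin (n + 1))).Structure M :=
    constantsOn.structure (Fin.snoc (α := fun _ => M) a b)
  refine hχ' M ⟨fun {m} f x => ?_, fun {m} r x => ?_⟩
  · rcases f with f | f
    · rfl
    · cases m with
      | succ m => exact f.elim
      | zero =>
        change funMap (c f) x = (Fin.snoc (α := fun _ => M) a b f : M)
        revert f
        refine Fin.lastCases ?_ fun j => ?_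
        · rw [show c (Fin.last n) = (τ[[Fin n]]).con 0 from Fin.snoc_last _ _, Fin.snoc_last]
          rfl
        · rw [show c j.castSucc = Sum.inl (τ.con j) from Fin.snoc_castSucc _ _ _,
            Fin.snoc_castSucc]
          rfl
  · rcases r with r | r
    · rfl
    · exact r.elim

theorem all (hL : L.IsRegular)
    {P : ∀ (M : Type u) [τ.Structure M] [Nonempty M], (Fin (n + 1) → M) → Prop}
    (h : L.Definable τ (n + 1) P) :
    L.Definable τ n fun M _ _ a => ∀ b : M, P M (Fin.snoc a b) :=
  (((h.not hL).ex hL).not hL).congr fun _ _ _ _ => by push Not; rfl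

theorem sentence_of_forall (hL : L.IsRegular)
    {P : ∀ (M : Type u) [τ.Structure M] [Nonempty M], (Fin n → M) → Prop}
    (h : L.Definable τ n P) :
    ∃ ψ : L.Sentence τ, ∀ (M : Type u) [τ.Structure M] [Nonempty M],
      L.Sat M ψ ↔ ∀ a, P M a := by
  induction n with
  | zero =>
    obtain ⟨χ, hχ⟩ := h
    let i : τ[[Fin 0]] →ᴸ τ := LHom.sumElim (LHom.id τ) (LHom.ofConstants Fin.elim0)
    obtain ⟨ψ, hψ⟩ := hL.exists_transfer i χ
    refine ⟨ψ, fun M _ _ => ?_⟩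
    let : (constantsOn (Fin 0)).Structure M := constantsOn.structure Fin.elim0
    refine (hψ M ⟨fun {m} f x => ?_, fun {m} r x => ?_⟩).trans ?_
    · rcases f with f | f
      · rfl
      · cases m with
        | succ m => exact f.elim
        | zero => exact Fin.elim0 f
    · rcases r with r | r
      · rfl
      · exact r.elim
    · refine (hχ M Fin.elim0).trans ⟨fun h a => ?_, fun h => h _⟩
      rwa [Subsingleton.elim a Fin.elim0]
  | succ n ih =>
    obtain ⟨ψ, hψ⟩ := ih (h.all hL)
    refine ⟨ψ, fun M _ _ => (hψ M).trans ⟨fun h a => ?_, fun h a b => h _⟩⟩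
    have := h (Fin.init a) (a (Fin.last n))
    rwa [Fin.snoc_init_self] at this

theorem false (hL : L.IsRegular) : L.Definable τ n fun _ _ _ _ => False :=
  -- For `n = 0` there may be no term at all, so falsity is expressed as the negation of `∃ x, x =
  -- x`, using that structures are nonempty.
  (((Definable.eq hL (Term.var (Sum.inr (Fin.last n))) (Term.var (Sum.inr (Fin.last n)))).ex
    hL).not hL).congr fun _ _ _ _ => by simp

/-- A regular logic contains first-order logic. -/
theorem formula (hL : L.IsRegular) (φ : τ.BoundedFormula Empty n) :
    L.Definable τ n fun _ _ _ a => φ.Realize Empty.elim a := by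
  induction φ with
  | falsum => exact false hL
  | equal s t => exact eq hL s t
  | rel r ts => exact rel hL r ts
  | imp _ _ h₁ h₂ => exact h₁.imp hL h₂
  | all _ h => exact h.all hL

end Definable

theorem IsRegular.exists_sentence (hL : L.IsRegular) {τ : FirstOrder.Language.{u, u}}
    (θ : τ.Sentence) : ∃ ψ : L.Sentence τ, ∀ (M : Type u) [τ.Structure M] [Nonempty M],
      L.Sat M ψ ↔ M ⊨ θ := by
  obtain ⟨ψ, hψ⟩ := (Definable.formula hL θ).sentence_of_forall hL
  refine ⟨ψ, fun M _ _ => (hψ M).trans ?_⟩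
  rw [Sentence.Realize, Formula.Realize, Subsingleton.elim (default : Empty → M) Empty.elim]
  exact ⟨fun h => h _, fun h a => by rwa [Subsingleton.elim a default]⟩

end AbstractLogic

/-! ### Relativized interpretations -/

/-- A single unary relation symbol. -/
inductive PredRel : ℕ → Type u
  | pred : PredRel 1

/-- The language of one unary relation symbol. -/
def predLang : FirstOrder.Language.{u, u} :=
  ⟨fun _ => PEmpty, PredRel⟩

namespace AbstractLogic

variable {L : AbstractLogic.{u, w}}

theorem Definable.forall_fin (hL : L.IsRegular) {τ : FirstOrder.Language.{u, u}} {n k : ℕ}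
    {P : Fin k → ∀ (M : Type u) [τ.Structure M] [Nonempty M], (Fin n → M) → Prop}
    (h : ∀ i, L.Definable τ n (P i)) : L.Definable τ n fun M _ _ a => ∀ i, P i M a := by
  induction k with
  | zero => exact ((Definable.false hL).not hL).congr fun _ _ _ _ => by simp
  | succ k ih =>
    exact ((h 0).and hL (ih fun i => h i.succ)).congr fun M _ _ a =>
      (Fin.forall_fin_succ (P := fun i => P i M a)).symm

/-- Relativization and substitution combined: the logic can speak about a substructure of a
definable structure. -/
theorem IsRegular.exists_interpretation (hL : L.IsRegular) {σ τ : FirstOrder.Language.{u, u}}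
    {PU : ∀ (M : Type u) [τ.Structure M] [Nonempty M], (Fin 1 → M) → Prop}
    {PR : ∀ n, σ.Relations n → ∀ (M : Type u) [τ.Structure M] [Nonempty M], (Fin n → M) → Prop}
    {PF : ∀ n, σ.Functions n → ∀ (M : Type u) [τ.Structure M] [Nonempty M],
      (Fin (n + 1) → M) → Prop}
    (hU : L.Definable τ 1 PU) (hR : ∀ n r, L.Definable τ n (PR n r))
    (hF : ∀ n f, L.Definable τ (n + 1) (PF n f)) (φ : L.Sentence σ) :
    ∃ ψ : L.Sentence τ, ∀ (M : Type u) [τ.Structure M] [Nonempty M] [σ.Structure M],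
      (∀ n (r : σ.Relations n) (x : Fin n → M), RelMap r x ↔ PR n r M x) →
      (∀ n (f : σ.Functions n) (x : Fin n → M) (y : M),
        funMap f x = y ↔ PF n f M (Fin.snoc x y)) →
      ∀ (U : σ.Substructure M) [Nonempty U], (∀ a : M, a ∈ U ↔ PU M ![a]) →
        (L.Sat M ψ ↔ L.Sat U φ) := by
  -- Relativize to a fresh predicate first; the substitution that interprets `σ` then also replaces
  -- this predicate by `PU`.
  obtain ⟨χ, hχ⟩ := Definable.rel hL (τ := σ.sum predLang.{u}) (n := 1) (k := 1)
    (Sum.inr PredRel.pred) fun i => Term.var (Sum.inr i)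
  obtain ⟨φ', hφ'⟩ := hL.relativization (LHom.sumInl : σ →ᴸ σ.sum predLang.{u})
    LHom.sumInl_injective φ χ
  choose χR hχR using hR
  choose χF hχF using hF
  obtain ⟨χU, hχU⟩ := hU
  obtain ⟨ψ, hψ⟩ := hL.substitution (σ := σ.sum predLang.{u}) (τ := τ)
    (fun n r => match n, r with
      | n, Sum.inl r => χR n r
      | _, Sum.inr .pred => χU)
    (fun n f => match f with
      | Sum.inl f => χF n f
      | Sum.inr f => f.elim) φ'
  refine ⟨ψ, fun M _ _ _ hMR hMF U _ hMU => ?_⟩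
  let : predLang.{u}.Structure M :=
    { funMap := fun f => f.elim
      RelMap := fun r => match r with
        | .pred => fun x => PU M x }
  refine (hψ M ?_ ?_).trans (hφ' M U fun a => ?_)
  · rintro n (r | r) x
    · exact (hMR n r x).trans (hχR n r M x).symm
    · cases r
      exact (hχU M x).symm
  · rintro n (f | f) x y
    · exact (hMF n f x y).trans (hχF n f M _).symm
    · exact f.elim
  · exact (hMU a).trans (hχ M ![a]).symm

end AbstractLogic

/-! ### Fibers as guarded substructures -/

section Guarded

variable {σ : FirstOrder.Language.{u, u}} {D : Type u} (p : D → Prop) (d : D)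
  (F : ∀ n, σ.Functions n → (Fin n → D) → D) (Q : ∀ n, σ.Relations n → (Fin n → D) → Prop)

open Classical in
/-- The structure with the given operations, except that values outside `p` are replaced by `d`. -/
@[reducible] noncomputable def guardedStructure : σ.Structure D where
  funMap {n} f x := if p (F n f x) then F n f x else d
  RelMap {n} r x := Q n r x

/-- The substructure of `guardedStructure` with domain `p`. -/
def guardedSubstructure (hd : p d) :
    letI := guardedStructure p d F Q
    σ.Substructure D :=
  letI := guardedStructure p d F Q
  { carrier := {x | p x}
    fun_mem := fun {n} f x _ => by
      by_cases h : p (F n f x)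
      · exact (congrArg p (if_pos h)).mpr h
      · exact (congrArg p (if_neg h)).mpr hd }

end Guarded

namespace AbstractLogic

variable {L : AbstractLogic.{u, w}}

/-- Satisfaction in the substructure with domain `p` of `guardedStructure p d F Q`. -/
def SatGuarded (L : AbstractLogic.{u, w}) {σ : FirstOrder.Language.{u, u}} {D : Type u}
    (p : D → Prop) (d : D) (F : ∀ n, σ.Functions n → (Fin n → D) → D)
    (Q : ∀ n, σ.Relations n → (Fin n → D) → Prop) (hd : p d) (φ : L.Sentence σ) : Prop :=
  letI := guardedStructure p d F Q
  haveI : Nonempty (guardedSubstructure p d F Q hd) := ⟨⟨d, hd⟩⟩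
  L.Sat (guardedSubstructure p d F Q hd) φ

theorem realize_cons {τ : FirstOrder.Language.{u, u}} {M : Type u} [τ.Structure M] {α : Type*}
    {n : ℕ} (v : α → M) (t : τ.Term α) (ts : Fin n → τ.Term α) :
    (fun i => (Fin.cons (α := fun _ => τ.Term α) t ts i).realize v) =
      Fin.cons (α := fun _ => M) (t.realize v) fun i => (ts i).realize v := by
  funext i
  refine Fin.cases ?_ (fun i => ?_) i <;> simp

/-- In a language with a constant `z`, a binary relation `E` and a unary function `d`, the logic
can speak about the structure with domain `E(z, ·)` and operations and relations with first
argument `z`. -/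
theorem IsRegular.exists_fiber (hL : L.IsRegular) {σ τ : FirstOrder.Language.{u, u}}
    (z : τ.Constants) (E : τ.Relations 2) (d : τ.Functions 1)
    (sF : ∀ n, σ.Functions n → τ.Functions (n + 1))
    (sR : ∀ n, σ.Relations n → τ.Relations (n + 1)) (φ : L.Sentence σ) :
    ∃ ψ : L.Sentence τ, ∀ (M : Type u) [τ.Structure M] [Nonempty M]
      (hd : RelMap E ![(z : M), funMap d ![(z : M)] ]),
      L.Sat M ψ ↔ L.SatGuarded (fun x => RelMap E ![(z : M), x]) (funMap d ![(z : M)])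
        (fun n f x => funMap (sF n f) (Fin.cons (α := fun _ => M) (z : M) x))
        (fun n r x => RelMap (sR n r) (Fin.cons (α := fun _ => M) (z : M) x)) hd φ := by
  have hE : ∀ {n : ℕ} (t : τ.Term (Empty ⊕ Fin n)), L.Definable τ n fun M _ _ a =>
      RelMap E ![(z : M), t.realize (Sum.elim Empty.elim a)] := fun t =>
    (Definable.rel hL E (Fin.cons z.term fun _ => t)).congr fun M _ _ a => by
      rw [realize_cons, Term.realize_constants]
      exact Iff.of_eq (congrArg _ (funext (by simp [Fin.forall_fin_two])))
  obtain ⟨ψ, hψ⟩ := hL.exists_interpretation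
    (PU := fun M _ _ a => RelMap E ![(z : M), a 0])
    (PR := fun n r M _ _ a => RelMap (sR n r) (Fin.cons (α := fun _ => M) (z : M) a))
    (PF := fun n f M _ _ a =>
      -- The graph of the guarded operation. Guarding makes the fiber closed under all operations
      -- with no axioms beyond the membership of the default value. This matters because the
      -- vocabulary `σ` may have more than `κ` symbols.
      (RelMap E ![(z : M), funMap (sF n f) (Fin.cons (α := fun _ => M) (z : M) (Fin.init a))] ∧
        funMap (sF n f) (Fin.cons (α := fun _ => M) (z : M) (Fin.init a)) = a (Fin.last n)) ∨
      (¬ RelMap E ![(z : M), funMap (sF n f) (Fin.cons (α := fun _ => M) (z : M) (Fin.init a))] ∧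
        funMap d ![(z : M)] = a (Fin.last n)))
    (hE (Term.var (Sum.inr 0)))
    (fun n r => (Definable.rel hL (sR n r) (Fin.cons z.term fun i => Term.var (Sum.inr i))).congr
      fun M _ _ a => by
        rw [realize_cons, Term.realize_constants]
        exact Iff.rfl)
    (fun n f => by
      let t : τ.Term (Empty ⊕ Fin (n + 1)) :=
        Term.func (sF n f) (Fin.cons z.term fun i => Term.var (Sum.inr i.castSucc))
      have ht : ∀ (M : Type u) [τ.Structure M] (a : Fin (n + 1) → M),
          t.realize (Sum.elim Empty.elim a) =
            funMap (sF n f) (Fin.cons (α := fun _ => M) (z : M) (Fin.init a)) := by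
        intro M _ a
        simp only [t, Term.realize_func]
        rw [realize_cons, Term.realize_constants]
        rfl
      have hl := Definable.eq hL t (Term.var (Sum.inr (Fin.last n)))
      have hr := Definable.eq hL (Term.func d ![(z.term : τ.Term (Empty ⊕ Fin (n + 1)))])
        (Term.var (Sum.inr (Fin.last n)))
      refine (((hE t).and hL hl).or hL (((hE t).not hL).and hL hr)).congr fun M _ _ a => ?_
      rw [ht]
      have : (Term.func d ![(z.term : τ.Term (Empty ⊕ Fin (n + 1)))]).realize
          (Sum.elim Empty.elim a) = funMap d ![(z : M)] := by
        simp only [Term.realize_func]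
        congr 1
        funext i
        fin_cases i
        exact Term.realize_constants
      rw [this]
      exact Iff.rfl) φ
  refine ⟨ψ, fun M _ _ hd => ?_⟩
  let := guardedStructure (fun x => RelMap E ![(z : M), x]) (funMap d ![(z : M)])
    (fun n (f : σ.Functions n) x => funMap (sF n f) (Fin.cons (α := fun _ => M) (z : M) x))
    (fun n r x => RelMap (sR n r) (Fin.cons (α := fun _ => M) (z : M) x))
  have : Nonempty (guardedSubstructure (fun x => RelMap E ![(z : M), x]) (funMap d ![(z : M)])
    (fun n (f : σ.Functions n) x => funMap (sF n f) (Fin.cons (α := fun _ => M) (z : M) x))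
    (fun n r x => RelMap (sR n r) (Fin.cons (α := fun _ => M) (z : M) x)) hd) := ⟨⟨_, hd⟩⟩
  refine hψ M (fun n r x => Iff.rfl) (fun n f x y => ?_) _ fun a => Iff.rfl
  rw [Fin.init_snoc, Fin.snoc_last]
  by_cases h : RelMap E ![(z : M), funMap (sF n f) (Fin.cons (α := fun _ => M) (z : M) x)]
  · refine (Iff.of_eq (congrArg (· = y) (if_pos h))).trans ?_
    simp [h]
  · refine (Iff.of_eq (congrArg (· = y) (if_neg h))).trans ?_
    simp [h]

/-- A substructure which is the image of a section of a map that commutes with all operations and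
relations satisfies the same sentences as the target of that map. -/
theorem sat_substructure_iff_of_retract {σ : FirstOrder.Language.{u, u}} {A D : Type u}
    [σ.Structure A] [Nonempty A] [σ.Structure D] {e : A → D} {q : D → A}
    (hqe : ∀ a, q (e a) = a)
    (hF : ∀ n (f : σ.Functions n) (x : Fin n → D), funMap f x = e (funMap f (q ∘ x)))
    (hR : ∀ n (r : σ.Relations n) (x : Fin n → D), RelMap r x ↔ RelMap r (q ∘ x))
    (U : σ.Substructure D) [Nonempty U] (hU : ∀ x, x ∈ U ↔ ∃ a, e a = x) (φ : L.Sentence σ) :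
    L.Sat U φ ↔ L.Sat A φ := by
  refine (L.sat_iso A U ⟨{ toFun := fun a => ⟨e a, (hU _).2 ⟨a, rfl⟩⟩
                           invFun := fun x => q x
                           left_inv := hqe
                           right_inv := ?_
                           map_fun' := ?_
                           map_rel' := ?_ }⟩ φ).symm
  · rintro ⟨x, hx⟩
    obtain ⟨a, rfl⟩ := (hU x).1 hx
    simp [hqe]
  · intro n f x
    refine Subtype.ext (Eq.trans ?_ (hF n f _).symm)
    exact congrArg e (congrArg _ (funext fun i => (hqe (x i)).symm))
  · intro n r x
    refine (hR n r _).trans (Iff.of_eq (congrArg _ (funext fun i => hqe (x i))))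

/-- The operations already take values in the range of `e`, so the guard never acts. This identifies
the fibers of an actual bundle with the structures it was built from. -/
theorem satGuarded_iff_of_retract {σ : FirstOrder.Language.{u, u}} {A D : Type u}
    [σ.Structure A] [Nonempty A] {p : D → Prop} {d : D}
    {F : ∀ n, σ.Functions n → (Fin n → D) → D} {Q : ∀ n, σ.Relations n → (Fin n → D) → Prop}
    {e : A → D} {q : D → A} (hqe : ∀ a, q (e a) = a) (hp : ∀ x, p x ↔ ∃ a, e a = x)
    (hF : ∀ n (f : σ.Functions n) (x : Fin n → D), F n f x = e (funMap f (q ∘ x)))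
    (hR : ∀ n (r : σ.Relations n) (x : Fin n → D), Q n r x ↔ RelMap r (q ∘ x))
    (hd : p d) (φ : L.Sentence σ) : L.SatGuarded p d F Q hd φ ↔ L.Sat A φ := by
  let := guardedStructure p d F Q
  have : Nonempty (guardedSubstructure p d F Q hd) := ⟨⟨d, hd⟩⟩
  refine sat_substructure_iff_of_retract hqe (fun n f x => ?_) hR _ hp φ
  rw [← hF]
  exact if_pos ((hp _).2 ⟨_, (hF n f x).symm⟩)

end AbstractLogic

/-! ### Bundles of structures over an expansion -/

/-- The operation symbols of a bundle of `τ`-structures: a distinguished point of the base, a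
section, and the operations of `τ` with the base point as an additional first argument. -/
inductive BundleFn (τ : FirstOrder.Language.{u, u}) : ℕ → Type u
  | point : BundleFn τ 0
  | sect : BundleFn τ 1
  | op {n : ℕ} (f : τ.Functions n) : BundleFn τ (n + 1)

/-- The relation symbols of a bundle of `τ`-structures: the base, the fiber relation, propositional
symbols indexed by `J`, and the relations of `τ` with the base point as an additional first
argument. -/
inductive BundleRel (τ : FirstOrder.Language.{u, u}) (J : Type u) : ℕ → Type u
  | base : BundleRel τ J 1
  | fiber : BundleRel τ J 2
  | flag (j : J) : BundleRel τ J 0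
  | rel {n : ℕ} (r : τ.Relations n) : BundleRel τ J (n + 1)

/-- The language of bundles of `τ`-structures. -/
def bundleLang (τ : FirstOrder.Language.{u, u}) (J : Type u) : FirstOrder.Language.{u, u} :=
  ⟨BundleFn τ, BundleRel τ J⟩

section BundleStructure

variable {A : Type u} (M : A → Type u) [∀ a, Nonempty (M a)]

/-- The base point of an element of the total space. -/
def bundleProj : A ⊕ (Σ a, M a) → A := Sum.elim id Sigma.fst

open Classical in
/-- The component of an element of the total space in the fiber over `a`. -/
noncomputable def bundleCoord (a : A) : A ⊕ (Σ a, M a) → M a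
  | Sum.inr ⟨b, m⟩ => if h : b = a then h ▸ m else Classical.arbitrary (M a)
  | Sum.inl _ => Classical.arbitrary (M a)

theorem bundleCoord_inr (a : A) (m : M a) : bundleCoord M a (Sum.inr ⟨a, m⟩) = m := by
  simp [bundleCoord]

/-- A family of `τ`-structures, as a structure on the disjoint union of the base and the fibers. -/
@[reducible] noncomputable def bundleStructure (τ : FirstOrder.Language.{u, u}) {J : Type u}
    [∀ a, τ.Structure (M a)] (out : J → A → Prop) (c : A) :
    (bundleLang τ J).Structure (A ⊕ (Σ a, M a)) where
  funMap f := match f with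
    | .point => fun _ => Sum.inl c
    | .sect => fun x => Sum.inr ⟨bundleProj M (x 0), Classical.arbitrary _⟩
    | .op f => fun x => Sum.inr ⟨bundleProj M (x 0),
        funMap f (bundleCoord M (bundleProj M (x 0)) ∘ Fin.tail x)⟩
  RelMap r := match r with
    | .base => fun x => ∃ a, Sum.inl a = x 0
    | .fiber => fun x => ∃ m : M (bundleProj M (x 0)), Sum.inr ⟨_, m⟩ = x 1
    | .flag j => fun _ => out j c
    | .rel r => fun x => RelMap r (bundleCoord M (bundleProj M (x 0)) ∘ Fin.tail x)

/-- The structure of the base, transported to the total space. -/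
@[reducible] noncomputable def bundleBaseStructure (K : FirstOrder.Language.{u, u})
    [K.Structure A] : K.Structure (A ⊕ (Σ a, M a)) where
  funMap f x := Sum.inl (funMap f (bundleProj M ∘ x))
  RelMap r x := RelMap r (bundleProj M ∘ x)

end BundleStructure

/-! ### Transfer of compactness through a bundle -/

namespace AbstractLogic

variable {L : AbstractLogic.{u, w}}

/-- Compactness for families: if for each `a` all `Γ t` and the `ψ j` with `out j a` have a common
model, then all `Γ t` and all `ψ j` have one. -/
def FamilyCompact (L : AbstractLogic.{u, w}) (κ : Cardinal.{u}) {J A : Type u}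
    (out : J → A → Prop) : Prop :=
  ∀ (τ : FirstOrder.Language.{u, u}) (T : Type u) (Γ : T → L.Sentence τ) (ψ : J → L.Sentence τ),
    #T ≤ κ →
    (∀ a : A, ∃ (M : Type u) (_ : τ.Structure M) (_ : Nonempty M),
      (∀ t, L.Sat M (Γ t)) ∧ ∀ j, out j a → L.Sat M (ψ j)) →
    ∃ (M : Type u) (_ : τ.Structure M) (_ : Nonempty M),
      (∀ t, L.Sat M (Γ t)) ∧ ∀ j, L.Sat M (ψ j)

theorem exists_sat_iff_satGuarded (L : AbstractLogic.{u, w}) {σ : FirstOrder.Language.{u, u}}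
    {D : Type u} (p : D → Prop) (d : D) (F : ∀ n, σ.Functions n → (Fin n → D) → D)
    (Q : ∀ n, σ.Relations n → (Fin n → D) → Prop) (hd : p d) :
    ∃ (N : Type u) (_ : σ.Structure N) (_ : Nonempty N),
      ∀ φ : L.Sentence σ, L.Sat N φ ↔ L.SatGuarded p d F Q hd φ :=
  let := guardedStructure p d F Q
  ⟨guardedSubstructure p d F Q hd, inferInstance, ⟨⟨d, hd⟩⟩, fun _ => Iff.rfl⟩

/-- The base point becomes a new constant, so that a sentence about its fiber turns into a formula
with a free variable, which can be quantified over the base. -/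
theorem IsRegular.exists_bundle_fiber (hL : L.IsRegular) (K : FirstOrder.Language.{u, u})
    {τ : FirstOrder.Language.{u, u}} (J : Type u) (φ : L.Sentence τ) :
    ∃ χ : L.Sentence ((K.sum (bundleLang τ J))[[Fin 1]]),
      ∀ (D : Type u) [(K.sum (bundleLang τ J)).Structure D] [Nonempty D] (z : D)
        (hd : RelMap (L := K.sum (bundleLang τ J)) (Sum.inr .fiber)
          ![z, funMap (L := K.sum (bundleLang τ J)) (Sum.inr .sect) ![z] ]),
        L.SatAt D χ ![z] ↔ L.SatGuarded
          (fun x => RelMap (L := K.sum (bundleLang τ J)) (Sum.inr .fiber) ![z, x])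
          (funMap (L := K.sum (bundleLang τ J)) (Sum.inr .sect) ![z])
          (fun _ f x => funMap (L := K.sum (bundleLang τ J)) (Sum.inr (.op f))
            (Fin.cons (α := fun _ => D) z x))
          (fun _ r x => RelMap (L := K.sum (bundleLang τ J)) (Sum.inr (.rel r))
            (Fin.cons (α := fun _ => D) z x)) hd φ := by
  obtain ⟨χ, hχ⟩ := hL.exists_fiber (τ := (K.sum (bundleLang τ J))[[Fin 1]])
    ((K.sum (bundleLang τ J)).con 0) (Sum.inl (Sum.inr .fiber)) (Sum.inl (Sum.inr .sect))
    (fun _ f => Sum.inl (Sum.inr (.op f))) (fun _ r => Sum.inl (Sum.inr (.rel r))) φ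
  refine ⟨χ, fun D _ _ z hd => ?_⟩
  let : (constantsOn (Fin 1)).Structure D := constantsOn.structure ![z]
  exact hχ D hd

/-- The bundle argument. The maps `f` and `g` absorb the change of cofinal families on the two
sides, and `ρ` tells which of the given models becomes the fiber over a base point. Compactness is
applied to propositional flags indexed by `J`. Many `i` may share one flag `f i`, so what a flag
forces is stated by separate implications in the theory. As flags are not part of that theory, `J`
needs no cardinality bound. -/
theorem IsRegular.familyCompact_of_expansion (hL : L.IsRegular) {κ : Cardinal.{u}} (hκ : ℵ₀ ≤ κ)
    {A C I J I' J' : Type u} [Nonempty A] (K : FirstOrder.Language.{u, u}) [K.Structure A]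
    (hA : #A ≤ κ) (hK : K.card ≤ κ) (hI : #I ≤ κ) (hJ' : #J' ≤ κ)
    (R : K.Relations 1) (v : I → K.Relations 1) (w : I' → K.Relations 1)
    (hext : ∀ (B : Type u) [K.Structure B], Nonempty (A ↪ₑ[K] B) →
      (∃ x : B, ∀ i, ¬ RelMap (v i) ![x]) → ∃ y : B, RelMap R ![y] ∧ ∀ i, ¬ RelMap (w i) ![y])
    {out : J → A → Prop} (hout : L.FamilyCompact κ out) (f : I → J)
    (hf : ∀ i a, out (f i) a → ¬ RelMap (v i) ![a])
    {out' : J' → C → Prop} (g : J' → I') (ρ : A → C)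
    (hg : ∀ j a, RelMap R ![a] → ¬ RelMap (w (g j)) ![a] → out' j (ρ a)) :
    L.FamilyCompact κ out' := by
  intro τ T Γ ψ hT hmod
  choose M hMs hMn hMΓ hMψ using fun a => hmod (ρ a)
  let Λ : FirstOrder.Language.{u, u} := (K[[A]]).sum (bundleLang τ J)
  let bR : Λ.Relations 1 := Sum.inr .base
  let fR : Λ.Relations 2 := Sum.inr .fiber
  let kR : K.Relations 1 → Λ.Relations 1 := fun r => Sum.inl (Sum.inl r)
  let pt : Λ.Constants := Sum.inr BundleFn.point
  let sF : Λ.Functions 1 := Sum.inr .sect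
  have hrel : ∀ {n : ℕ} (r : Λ.Relations 1) (t : Λ.Term (Empty ⊕ Fin n)),
      L.Definable Λ n fun D _ _ a => RelMap r ![t.realize (Sum.elim Empty.elim a)] := fun r t =>
    (Definable.rel hL r ![t]).congr fun D _ _ a =>
      Iff.of_eq (congrArg _ (funext (by simp)))
  have hvar : ∀ {n : ℕ} (r : Λ.Relations 1) (i : Fin n),
      L.Definable Λ n fun D _ _ a => RelMap r ![a i] := fun r i =>
    hrel r (Term.var (Sum.inr i))
  have hpt : ∀ (r : Λ.Relations 1), L.Definable Λ 0 fun D _ _ _ => RelMap r ![(pt : D)] := fun r =>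
    (hrel r pt.term).congr fun D _ _ a => by rw [Term.realize_constants]
  -- the elementary diagram of the base
  obtain ⟨χ, hχ⟩ := hvar bR (0 : Fin 1)
  choose fo hfo using fun θ : (K[[A]]).Sentence => hL.exists_sentence θ
  choose diag hdiag using fun θ : (K[[A]]).Sentence =>
    hL.relativization (LHom.sumInl : K[[A]] →ᴸ Λ) LHom.sumInl_injective (fo θ) χ
  -- the base is closed and contains the distinguished point
  have hcl : ∀ s : (Σ n, (K[[A]]).Functions n), ∃ ψ : L.Sentence Λ,
      ∀ (D : Type u) [Λ.Structure D] [Nonempty D], L.Sat D ψ ↔ ∀ a : Fin s.1 → D,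
        (∀ i, RelMap bR ![a i]) → RelMap bR ![funMap (L := Λ) (Sum.inl s.2) a] := fun s =>
    ((Definable.forall_fin hL fun i => hvar bR i).imp hL
      (hrel bR (Term.func (Sum.inl s.2) fun i => Term.var (Sum.inr i)))).sentence_of_forall hL
  choose cl hcl using hcl
  obtain ⟨bpt, hbpt⟩ := (hpt bR).sentence_of_forall hL
  -- the fibers over the base are nonempty
  obtain ⟨ne, hne⟩ := ((hvar bR (0 : Fin 1)).imp hL
    ((Definable.rel hL fR ![Term.var (Sum.inr 0), Term.func sF ![Term.var (Sum.inr 0)] ]).congr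
      (Q := fun D _ _ a => RelMap fR ![a 0, funMap sF ![a 0] ]) fun D _ _ a =>
      Iff.of_eq (congrArg _ (funext (by
        simp only [Fin.forall_fin_two]
        refine ⟨rfl, ?_⟩
        change funMap sF _ = funMap sF _
        exact congrArg _ (funext (by simp))))))).sentence_of_forall hL
  -- the fibers satisfy the given sentences
  choose fib hfib using fun φ : L.Sentence τ => hL.exists_bundle_fiber (K[[A]]) J φ
  choose gam hgam using fun t : T =>
    ((hvar bR (0 : Fin 1)).imp hL (Definable.satAt (fib (Γ t)))).sentence_of_forall hL
  choose psi hpsi using fun j : J' => ((hvar bR (0 : Fin 1)).imp hL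
    ((hvar (kR R) (0 : Fin 1)).imp hL (((hvar (kR (w (g j))) (0 : Fin 1)).not hL).imp hL
      (Definable.satAt (fib (ψ j)))))).sentence_of_forall hL
  -- the flags force the distinguished point out of the given sets
  have hfl : ∀ j : J, ∃ ψ : L.Sentence Λ, ∀ (D : Type u) [Λ.Structure D] [Nonempty D],
      L.Sat D ψ ↔ RelMap (L := Λ) (Sum.inr (.flag j)) (![] : Fin 0 → D) := fun j => by
    obtain ⟨ψ, hψ⟩ := (Definable.rel hL (τ := Λ) (n := 0) (Sum.inr (.flag j)) ![]).sentence_of_forall hL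
    refine ⟨ψ, fun D _ _ => (hψ D).trans ?_⟩
    simp only [Subsingleton.elim _ (![] : Fin 0 → D), forall_const]
  choose flag hflag using hfl
  choose con hcon using fun i : I =>
    ((Definable.rel hL (τ := Λ) (n := 0) (Sum.inr (.flag (f i))) ![]).imp hL
      ((hpt (kR (v i))).not hL)).sentence_of_forall hL
  -- The theory consists of the diagram, closure of the base, the distinguished point in the base,
  -- nonempty fibers, `Γ` in the fibers, the conditional `ψ j`, and the effect of the flags.
  have hcard : #({θ : (K[[A]]).Sentence // A ⊨ θ} ⊕ (Σ n, (K[[A]]).Functions n) ⊕ PUnit.{u + 1} ⊕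
      PUnit.{u + 1} ⊕ T ⊕ J' ⊕ I) ≤ κ := by
    have hKA : (K[[A]]).card ≤ κ := by
      rw [card_withConstants, lift_id, lift_id]
      exact add_le_of_le hκ hK hA
    have hone : #PUnit.{u + 1} ≤ κ := by
      rw [mk_punit]
      exact one_le_aleph0.trans hκ
    have hsen : #{θ : (K[[A]]).Sentence // A ⊨ θ} ≤ κ := by
      refine (mk_subtype_le _).trans ?_
      refine (mk_le_of_injective (f := fun θ : (K[[A]]).Sentence =>
        (⟨0, θ⟩ : Σ n, (K[[A]]).BoundedFormula Empty n))
        fun _ _ h => eq_of_heq (Sigma.mk.inj h).2).trans ?_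
      refine BoundedFormula.card_le.trans (max_le hκ ?_)
      simpa using hKA
    have hfun : #(Σ n, (K[[A]]).Functions n) ≤ κ :=
      (mk_le_of_injective (β := (K[[A]]).Symbols) Sum.inl_injective).trans hKA
    simp only [mk_sum, lift_id]
    exact add_le_of_le hκ hsen <| add_le_of_le hκ hfun <| add_le_of_le hκ hone <|
      add_le_of_le hκ hone <| add_le_of_le hκ hT <| add_le_of_le hκ hJ' hI
  -- For each `c` the model is the bundle of the `M a` with distinguished point `c`, where flag `j`
  -- is true exactly when `out j c`.
  obtain ⟨D, hDs, hDn, hDΓ, hDψ⟩ := hout Λ _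
    (Sum.elim (fun θ => diag θ.1) <| Sum.elim cl <| Sum.elim (fun _ => bpt) <|
      Sum.elim (fun _ => ne) <| Sum.elim gam <| Sum.elim psi con) flag hcard (fun c => by
    let : (K[[A]]).Structure (A ⊕ (Σ a, M a)) := bundleBaseStructure M (K[[A]])
    let : (bundleLang τ J).Structure (A ⊕ (Σ a, M a)) := bundleStructure M τ out c
    let : Λ.Structure (A ⊕ (Σ a, M a)) := sumStructure _ _ _
    have hfiber : ∀ a (φ : L.Sentence τ), L.SatAt (A ⊕ (Σ a, M a)) (fib φ) ![Sum.inl a] ↔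
        L.Sat (M a) φ := fun a φ => by
      refine (hfib φ (A ⊕ (Σ a, M a)) (Sum.inl a)
        (show ∃ m : M a, (Sum.inr ⟨a, m⟩ : A ⊕ (Σ a, M a)) = _ from ⟨_, rfl⟩)).trans ?_
      refine satGuarded_iff_of_retract (e := fun m : M a => Sum.inr ⟨a, m⟩)
        (q := bundleCoord M a) (bundleCoord_inr M a) (fun _ => Iff.rfl) (fun _ _ _ => rfl)
        (fun _ _ _ => Iff.rfl) _ φ
    refine ⟨A ⊕ (Σ a, M a), inferInstance, inferInstance, ?_, fun j hj => (hflag j _).2 hj⟩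
    simp only [Sum.forall, Sum.elim_inl, Sum.elim_inr]
    refine ⟨fun θ => ?_, fun s => ?_, fun _ => ?_, fun _ => ?_, fun t => ?_, fun j => ?_,
      fun i => ?_⟩
    · let U : (K[[A]]).Substructure (A ⊕ (Σ a, M a)) :=
        { carrier := {x | ∃ a, Sum.inl a = x}
          fun_mem := fun f x _ => ⟨_, rfl⟩ }
      have : Nonempty U := ⟨⟨Sum.inl c, c, rfl⟩⟩
      refine (hdiag θ.1 _ U fun x => (hχ _ ![x]).symm).2 ?_
      exact (sat_substructure_iff_of_retract (e := Sum.inl) (q := bundleProj M) (fun _ => rfl)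
        (fun _ _ _ => rfl) (fun _ _ _ => Iff.rfl) U (fun _ => Iff.rfl) _).2 ((hfo θ.1 A).2 θ.2)
    · exact (hcl s _).2 fun a _ => ⟨_, rfl⟩
    · exact (hbpt _).2 fun _ => ⟨_, rfl⟩
    · exact (hne _).2 fun _ _ => ⟨_, rfl⟩
    · refine (hgam t _).2 fun x hx => ?_
      obtain ⟨a, ha⟩ := hx
      obtain rfl : x = ![Sum.inl a] := funext (by simpa using ha.symm)
      exact (hfiber a _).2 (hMΓ a t)
    · refine (hpsi j _).2 fun x hx hR hw => ?_
      obtain ⟨a, ha⟩ := hx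
      obtain rfl : x = ![Sum.inl a] := funext (by simpa using ha.symm)
      have hproj : bundleProj M ∘ ![Sum.inl a] = ![a] := funext (by simp [bundleProj])
      refine (hfiber a _).2 (hMψ a j (hg j a ?_ fun h => hw ?_))
      · rw [← hproj]; exact hR
      · rw [← hproj] at h; exact h
    · refine (hcon i _).2 fun _ hfl h => hf i c hfl ?_
      have hproj : bundleProj M ∘ ![Sum.inl c] = ![c] := funext (by simp [bundleProj])
      rw [← hproj]; exact h)
  simp only [Sum.forall, Sum.elim_inl, Sum.elim_inr, forall_const] at hDΓ
  obtain ⟨h₁, h₂, h₃, h₄, h₅, h₆, h₇⟩ := hDΓ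
  let : (K[[A]]).Structure D := (LHom.sumInl : K[[A]] →ᴸ Λ).reduct D
  let U : (K[[A]]).Substructure D :=
    { carrier := {x | RelMap bR ![x]}
      fun_mem := fun f x hx => (hcl ⟨_, f⟩ D).1 (h₂ ⟨_, f⟩) x hx }
  have hptU : (pt : D) ∈ U := (hbpt D).1 h₃ ![]
  have : Nonempty U := ⟨⟨_, hptU⟩⟩
  let : K.Structure U := (K.lhomWithConstants A).reduct U
  have hmodel : U ⊨ K.elementaryDiagram A := by
    -- The relativized diagram, read back on the base of `D`, makes that base an elementary
    -- extension of `A`.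
    refine (Theory.model_iff _).2 fun θ hθ => (hfo θ U).1 ?_
    exact (hdiag θ D U fun x => (hχ D ![x]).symm).1 (h₁ ⟨θ, hθ⟩)
  have hsub : ∀ (r : K.Relations 1) (x : U), RelMap r ![x] ↔ RelMap (kR r) ![(x : D)] := by
    intro r x
    rw [show ![(x : D)] = (↑) ∘ ![x] from funext (by simp)]
    exact Iff.rfl
  -- All flags hold in `D`, so the distinguished point is the required element outside every `v i`.
  -- The fiber over the resulting `y` is the model sought.
  obtain ⟨y, hyR, hyw⟩ := hext U ⟨ElementaryEmbedding.ofModelsElementaryDiagram K A U⟩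
    ⟨⟨pt, hptU⟩, fun i hi => by
      refine (hcon i D).1 (h₇ i) ![] ?_ ?_
      · have := (hflag _ D).1 (hDψ (f i))
        rwa [Subsingleton.elim (![] : Fin 0 → D)] at this
      · exact (hsub _ _).1 hi⟩
  have hyE : RelMap fR ![(y : D), funMap sF ![(y : D)] ] := (hne D).1 h₄ ![(y : D)] y.2
  obtain ⟨N, _, _, hN⟩ := L.exists_sat_iff_satGuarded
    (fun x => RelMap fR ![(y : D), x]) (funMap sF ![(y : D)])
    (fun _ f x => funMap (L := Λ) (Sum.inr (.op f)) (Fin.cons (α := fun _ => D) (y : D) x))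
    (fun _ r x => RelMap (L := Λ) (Sum.inr (.rel r)) (Fin.cons (α := fun _ => D) (y : D) x)) hyE
  refine ⟨N, inferInstance, inferInstance, fun t => (hN _).2 ?_, fun j => (hN _).2 ?_⟩
  · exact (hfib _ D y hyE).1 ((hgam t D).1 (h₅ t) ![(y : D)] y.2)
  · refine (hfib _ D y hyE).1 ((hpsi j D).1 (h₆ j) ![(y : D)] y.2 ?_ fun h => hyw (g j) ?_)
    · exact (hsub R y).1 hyR
    · exact (hsub _ y).2 h

end AbstractLogic

/-! ### Cofinal families and cardinalities -/

/-- Diagonalization: choose a point outside each member of a family of fewer than `λ` small sets;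
the set of chosen points is small, yet no member covers it. It gives `λ ≤ κ`, needed to bound the
elementary diagram of the model on `λ`. -/
theorem CofinalInSmall.le_mk {lam : Cardinal.{u}} {V : Set (Set lam.ord.ToType)}
    (hV : CofinalInSmall lam lam V) : lam ≤ #V := by
  by_contra! hlt
  have hex : ∀ v : V, ∃ x, x ∉ v.1 := by
    intro v
    by_contra! hall
    have hv : #v.1 < lam := hV.1 v.2
    rw [Set.eq_univ_of_forall hall, mk_univ, mk_ord_toType] at hv
    exact hv.false
  choose x hx using hex
  obtain ⟨y, hy, hxy⟩ := hV.2 (Set.range x) (mk_range_le.trans_lt hlt)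
  exact hx ⟨y, hy⟩ (hxy ⟨⟨y, hy⟩, rfl⟩)

theorem card_baseLang_le {κ : Cardinal.{u}} (hκ : ℵ₀ ≤ κ) {I : Type u} (hI : #I ≤ κ) :
    (baseLang I).card ≤ κ := by
  have hinj : Function.Injective fun s : (baseLang I).Symbols =>
      (match s with
        | Sum.inr ⟨_, .mem v⟩ => some v
        | _ => none : Option I) := by
    rintro (⟨_, f⟩ | ⟨_, r⟩) (⟨_, f'⟩ | ⟨_, r'⟩) h
    · exact f.elim
    · exact f.elim
    · exact f'.elim
    · cases r <;> cases r' <;> simp_all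
  refine (mk_le_of_injective hinj).trans ?_
  rw [mk_option]
  exact add_le_of_le hκ hI (one_le_aleph0.trans hκ)

theorem inclOrd_injective {lam mu : Cardinal.{u}} (h : mu ≤ lam) :
    Function.Injective (inclOrd h) := by
  intro a b hab
  have := congrArg Subtype.val (Ordinal.ToType.mk.injective hab)
  exact Ordinal.ToType.mk.symm.injective (Subtype.ext this)

/-! ### Compactness from the relation `λ ⇒^κ μ` -/

namespace AbstractLogic

variable {L : AbstractLogic.{u, w}}

/-- Indexing the sentences by a type in universe `u` removes the universe lifts, since only sets `Γ`
of at most `κ` sentences occur. -/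
theorem kCompact_iff_familyCompact {κ lam : Cardinal.{u}} {V : Set (Set lam.ord.ToType)} :
    L.KCompact κ V ↔ L.FamilyCompact κ fun (v : V) γ => γ ∉ v.1 := by
  constructor
  · intro h τ T Γ ψ hT hmod
    obtain ⟨M, hMs, hMn, hM⟩ := h τ (Set.range Γ) ψ
      (mk_range_le_lift.trans (lift_le.2 hT)) fun γ => by
        obtain ⟨M, hMs, hMn, h₁, h₂⟩ := hmod γ
        refine ⟨M, hMs, hMn, ?_⟩
        rintro θ (⟨t, rfl⟩ | ⟨v, hv, rfl⟩)
        · exact h₁ t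
        · exact h₂ v hv
    exact ⟨M, hMs, hMn, fun t => hM _ (Or.inl ⟨t, rfl⟩), fun v => hM _ (Or.inr ⟨v, rfl⟩)⟩
  · intro h τ Γ φ hΓ hmod
    obtain ⟨c, hc, hcΓ⟩ := le_lift_iff.1 hΓ
    obtain ⟨T, rfl⟩ : ∃ T : Type u, #T = c := ⟨c.out, c.mk_out⟩
    obtain ⟨e⟩ := Cardinal.lift_mk_eq'.1 hcΓ
    obtain ⟨M, hMs, hMn, h₁, h₂⟩ := h τ T (fun t => (e t).1) φ hc fun γ => by
      obtain ⟨M, hMs, hMn, hM⟩ := hmod γ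
      exact ⟨M, hMs, hMn, fun t => hM _ (Or.inl (e t).2), fun v hv => hM _ (Or.inr ⟨v, hv, rfl⟩)⟩
    refine ⟨M, hMs, hMn, ?_⟩
    rintro θ (hθ | ⟨v, rfl⟩)
    · simpa using h₁ (e.symm ⟨θ, hθ⟩)
    · exact h₂ v

theorem IsRegular.kCompact_of_modelImplies (hL : L.IsRegular) {κ lam mu : Cardinal.{u}}
    (hmu : ℵ₀ ≤ mu) (hle : mu ≤ lam) (h : ModelImplies κ lam mu hle)
    {V : Set (Set lam.ord.ToType)} (hV : CofinalInSmall lam lam V) (hc : L.KCompact κ V)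
    {W : Set (Set mu.ord.ToType)} (hW : CofinalInSmall mu mu W) (hWκ : #W ≤ κ) :
    L.KCompact κ W := by
  obtain ⟨V₀, W₀, hV₀, hV₀κ, hW₀, hW₀κ, N, S, hN, hwit⟩ := h
  have hlam : lam ≤ κ := hV₀.le_mk.trans hV₀κ
  have hκ : ℵ₀ ≤ κ := (hmu.trans hle).trans hlam
  have : Nonempty lam.ord.ToType := mk_ne_zero_iff.1 (by
    rw [mk_ord_toType]
    exact (aleph0_pos.trans_le (hmu.trans hle)).ne')
  have : Nonempty mu.ord.ToType := mk_ne_zero_iff.1 (by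
    rw [mk_ord_toType]
    exact (aleph0_pos.trans_le hmu).ne')
  let K := (baseLang ↥(V₀ ∪ inLarger hle W₀)).sum N
  let : (baseLang ↥(V₀ ∪ inLarger hle W₀)).Structure lam.ord.ToType :=
    baseStructure hle (V₀ ∪ inLarger hle W₀)
  let : N.Structure lam.ord.ToType := S
  -- A point outside a superset is outside the set. Hence avoiding `V` gives avoiding `V₀`, and
  -- avoiding `W₀` gives avoiding `W`.
  choose f hfV hf using fun v : V₀ => hV.2 v.1 (hV₀.1 v.2)
  choose g hgW hg using fun w : W => hW₀.2 w.1 (hW.1 w.2)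
  rw [kCompact_iff_familyCompact] at hc ⊢
  -- The map `ρ` inverts the inclusion of `μ` in `λ`. Its values off `μ` are irrelevant, because the
  -- `ψ` are only required over points of `R`.
  refine hL.familyCompact_of_expansion hκ (I := V₀) (I' := W₀) K
    (by rwa [mk_ord_toType]) ?_ hV₀κ hWκ
    (Sum.inl BaseRel.R) (fun v => Sum.inl (.mem ⟨v.1, Or.inl v.2⟩))
    (fun w => Sum.inl (.mem ⟨_, Or.inr ⟨w.1, w.2, rfl⟩⟩)) ?_ hc (fun v => ⟨f v, hfV v⟩)
    (fun v a ha hva => ha (hf v hva)) (fun w => ⟨g w, hgW w⟩) (Function.invFun (inclOrd hle)) ?_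
  · rw [card_sum, lift_id, lift_id]
    refine add_le_of_le hκ (card_baseLang_le hκ ?_) hN
    exact (mk_union_le _ _).trans (add_le_of_le hκ hV₀κ (mk_image_le.trans hW₀κ))
  · rintro B _ hB ⟨x, hx⟩
    obtain ⟨y, hyR, hy⟩ := hwit B hB ⟨x, fun v hv => hx ⟨v.1, hv⟩⟩
    exact ⟨y, hyR, fun w => hy _ ⟨w.1, w.2, rfl⟩⟩
  · rintro w _ ⟨γ, rfl⟩ hw hγ
    refine hw ⟨γ, hg w ?_, rfl⟩
    rwa [Function.leftInverse_invFun (inclOrd_injective hle)] at hγ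

end AbstractLogic

/-! ### Decomposability and the full expansion -/

/-- Unary operation symbols for all self-maps of `X`. -/
inductive FullFn (X : Type u) : ℕ → Type u
  | map (f : X → X) : FullFn X 1

/-- Unary relation symbols for all subsets of `X`. -/
inductive FullRel (X : Type u) : ℕ → Type u
  | set (s : Set X) : FullRel X 1

/-- The language with symbols for all self-maps and all subsets of `X`. -/
def fullLang (X : Type u) : FirstOrder.Language.{u, u} :=
  ⟨FullFn X, FullRel X⟩

/-- The standard interpretation of the full language. -/
@[reducible] def fullStructure (X : Type u) : (fullLang X).Structure X where
  funMap f := match f with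
    | .map f => fun x => f (x 0)
  RelMap r := match r with
    | .set s => fun x => x 0 ∈ s

theorem card_fullLang_le (X : Type u) : (fullLang X).card ≤ #((X → X) ⊕ Set X) := by
  refine mk_le_of_injective (f := fun s : (fullLang X).Symbols =>
      (match s with
        | Sum.inl ⟨_, .map f⟩ => Sum.inl f
        | Sum.inr ⟨_, .set s⟩ => Sum.inr s : (X → X) ⊕ Set X)) ?_
  rintro (⟨_, ⟨f⟩⟩ | ⟨_, ⟨r⟩⟩) (⟨_, ⟨f'⟩⟩ | ⟨_, ⟨r'⟩⟩) h <;> simp_all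

theorem FirstOrder.Language.ElementaryEmbedding.realize_of_forall
    {K : FirstOrder.Language.{u, u}} {A B : Type u} [K.Structure A] [K.Structure B] (e : A ↪ₑ[K] B)
    (φ : K.BoundedFormula Empty 1) (h : ∀ a : A, φ.Realize default ![a]) (b : B) :
    φ.Realize default ![b] := by
  have hsnoc : ∀ {M : Type u} (a : M), (Fin.snoc default a : Fin 1 → M) = ![a] := fun a => by
    funext i
    fin_cases i
    rfl
  have hA : A ⊨ (φ.all : K.Sentence) := BoundedFormula.realize_all.2 fun a => by
    rw [hsnoc]
    exact h a
  have hB := BoundedFormula.realize_all.1 ((e.map_sentence φ.all).1 hA) b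
  rwa [hsnoc] at hB

/-- The sets whose names hold of `x` form an ultrafilter, and decomposing it by a named function
moves `x` to the required `y`. -/
theorem expansionWitnesses_full {lam mu : Cardinal.{u}} (h : mu ≤ lam)
    (hD : ∀ D : Ultrafilter lam.ord.ToType, UniformOver lam D → Decomposable mu D) :
    ExpansionWitnesses h (SmallSubsets lam lam) (SmallSubsets mu mu) (fullLang lam.ord.ToType)
      (fullStructure lam.ord.ToType) := by
  let A := lam.ord.ToType
  let I : Set (Set A) := SmallSubsets lam lam ∪ inLarger h (SmallSubsets mu mu)
  let K := (baseLang I).sum (fullLang A)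
  let : (baseLang I).Structure A := baseStructure h I
  let : (fullLang A).Structure A := fullStructure A
  change ∀ (B : Type u) [K.Structure B], Nonempty (A ↪ₑ[K] B) → _
  rintro B _ ⟨e⟩ R Rmem ⟨x, hx⟩
  let P : Set A → K.Relations 1 := fun s => Sum.inr (.set s)
  let X : K.Term (Empty ⊕ Fin 1) := Term.var (Sum.inr 0)
  have hP : ∀ (s : Set A) (a : A), RelMap (P s) ![a] ↔ a ∈ s := fun _ _ => Iff.rfl
  have himp : ∀ r₁ r₂ r₃ : K.Relations 1,
      (∀ a : A, RelMap r₁ ![a] → RelMap r₂ ![a] → RelMap r₃ ![a]) →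
      RelMap r₁ ![x] → RelMap r₂ ![x] → RelMap r₃ ![x] := fun r₁ r₂ r₃ h => by
    simpa [X] using e.realize_of_forall ((r₁.boundedFormula₁ X).imp
      ((r₂.boundedFormula₁ X).imp (r₃.boundedFormula₁ X))) (by simpa [X] using h) x
  have hcompl : ∀ s : Set A, RelMap (P sᶜ) ![x] ↔ ¬ RelMap (P s) ![x] := fun s => by
    simpa [X] using e.realize_of_forall (((P sᶜ).boundedFormula₁ X).iff
      ((P s).boundedFormula₁ X).not) (by simp [X, hP]) x
  have huniv : RelMap (P Set.univ) ![x] := by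
    simpa [X] using e.realize_of_forall ((P Set.univ).boundedFormula₁ X) (by simp [X, hP]) x
  let D : Ultrafilter A := Ultrafilter.ofComplNotMemIff
    { sets := {s | RelMap (P s) ![x]}
      univ_sets := huniv
      sets_of_superset := fun {s t} hs hst =>
        himp (P s) (P s) (P t) (fun a ha _ => hst ha) hs hs
      inter_sets := fun {s t} hs ht =>
        himp (P s) (P t) (P (s ∩ t)) (fun a ha hb => ⟨ha, hb⟩) hs ht }
    (fun s => by
      change ¬ RelMap (P sᶜ) ![x] ↔ RelMap (P s) ![x]
      rw [hcompl, not_not])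
  -- A member of size less than `λ` would be one of the sets `v` that `x` avoids.
  have hunif : UniformOver lam D := by
    intro s hs
    refine le_antisymm ((mk_set_le s).trans_eq (mk_ord_toType lam)) (not_lt.1 fun hlt => ?_)
    exact hx ⟨s, Or.inl hlt⟩ hlt
      (himp (P s) (P s) (Sum.inl (.mem ⟨s, Or.inl hlt⟩)) (fun a ha _ => ha) hs hs)
  obtain ⟨f, hf⟩ := hD D hunif
  -- Symbols exist only for self-maps of `λ`, so `f` is followed by the inclusion of `μ`.
  let F : K.Functions 1 := Sum.inr (.map fun a => inclOrd h (f a))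
  refine ⟨funMap F ![x], ?_, ?_⟩
  · have := BoundedFormula.realize_rel₁.1 (e.realize_of_forall
      (Relations.boundedFormula₁ (L := K) (Sum.inl BaseRel.R) (F.apply₁ X))
      (fun a => BoundedFormula.realize_rel₁.2 ⟨f a, rfl⟩) x)
    rw [Term.realize_functions_apply₁] at this
    exact this
  · rintro ⟨_, hv⟩ ⟨w, hw, rfl⟩ hR
    have hpre := e.realize_of_forall ((Relations.boundedFormula₁ (L := K)
      (Sum.inl (BaseRel.mem ⟨inclOrd h '' w, hv⟩)) (F.apply₁ X)).imp
        ((P (f ⁻¹' w)).boundedFormula₁ X)) (fun a => by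
          refine BoundedFormula.realize_imp.2 fun h₁ => BoundedFormula.realize_rel₁.2 ?_
          obtain ⟨γ, hγ, hγa⟩ := BoundedFormula.realize_rel₁.1 h₁
          have hγf : γ = f a := inclOrd_injective h hγa
          rw [hγf] at hγ
          exact hγ) x
    -- If the image of `x` lay in `w`, then `w` would be a member of size less than `μ` of the
    -- uniform ultrafilter `f(D)`.
    have hmem : f ⁻¹' w ∈ D := by
      refine BoundedFormula.realize_rel₁.1 (BoundedFormula.realize_imp.1 hpre
        (BoundedFormula.realize_rel₁.2 ?_))
      rw [Term.realize_functions_apply₁]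
      exact hR
    have hlt : #w < mu := hw
    rw [hf w hmem] at hlt
    exact hlt.false

theorem modelImplies_of_decomposable {κ lam mu : Cardinal.{u}} (h : mu ≤ lam)
    (hD : ∀ D : Ultrafilter lam.ord.ToType, UniformOver lam D → Decomposable mu D)
    (hlam : #(SmallSubsets lam lam) ≤ κ) (hmu : #(SmallSubsets mu mu) ≤ κ)
    (hκ : #((lam.ord.ToType → lam.ord.ToType) ⊕ Set lam.ord.ToType) ≤ κ) :
    ModelImplies κ lam mu h :=
  ⟨_, _, ⟨subset_rfl, fun x hx => ⟨x, hx, subset_rfl⟩⟩, hlam,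
    ⟨subset_rfl, fun x hx => ⟨x, hx, subset_rfl⟩⟩, hmu, _, _, (card_fullLang_le _).trans hκ,
    expansionWitnesses_full h hD⟩

/-! ### From `κ`-compactness for all large `κ` to `[λ]`-compactness -/

namespace AbstractLogic

variable {L : AbstractLogic.{u, w}}

/-- Every set `Γ` has at most `κ` elements for some `κ ≥ c`. The threshold `c` leaves room to assume
`κ` above the size of the full expansion. -/
theorem boxCompact_iff_forall_kCompact {lam : Cardinal.{u}} {V : Set (Set lam.ord.ToType)}
    (c : Cardinal.{u}) : L.BoxCompact V ↔ ∀ κ, c ≤ κ → L.KCompact κ V := by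
  constructor
  · intro h κ _ τ Γ φ hΓ
    obtain ⟨d, -, hd⟩ := le_lift_iff.1 hΓ
    rw [← d.mk_out] at hd
    obtain ⟨e⟩ := Cardinal.lift_mk_eq'.1 hd
    exact h τ Γ φ ⟨_, ⟨e.symm⟩⟩
  · intro h τ Γ φ hΓ
    refine h (max c #(Shrink.{u} Γ)) (le_max_left _ _) τ Γ φ ?_
    rw [Cardinal.lift_mk_eq'.2 ⟨equivShrink.{u} Γ⟩]
    exact lift_le.2 (le_max_right _ _)

theorem IsRegular.boxCompact_of_decomposable (hL : L.IsRegular) {lam mu : Cardinal.{u}}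
    (hmu : ℵ₀ ≤ mu) (hle : mu ≤ lam)
    (hD : ∀ D : Ultrafilter lam.ord.ToType, UniformOver lam D → Decomposable mu D)
    {V : Set (Set lam.ord.ToType)} (hV : CofinalInSmall lam lam V) (hc : L.BoxCompact V)
    {W : Set (Set mu.ord.ToType)} (hW : CofinalInSmall mu mu W) : L.BoxCompact W := by
  -- Such `κ` bound `W`, the two families of all small sets, which serve as the cofinal sets in `λ
  -- ⇒^κ μ`, and the new symbols. The given `V` need not be bounded, as it only indexes flags.
  refine (boxCompact_iff_forall_kCompact (#W + (#(SmallSubsets lam lam) +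
    (#(SmallSubsets mu mu) +
      #((lam.ord.ToType → lam.ord.ToType) ⊕ Set lam.ord.ToType))))).2 fun κ hκ => ?_
  have h₁ := le_self_add.trans hκ
  have h₂ := (le_add_self.trans hκ)
  have h₃ := (le_add_self.trans h₂)
  exact hL.kCompact_of_modelImplies hmu hle
    (modelImplies_of_decomposable hle hD (le_self_add.trans h₂) (le_self_add.trans h₃)
      (le_add_self.trans h₃)) hV ((boxCompact_iff_forall_kCompact 0).1 hc κ zero_le) hW h₁

end AbstractLogic

theorem mainTheorem3 (κ lam mu : Cardinal.{u}) (hmu : ℵ₀ ≤ mu) (hle : mu ≤ lam)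
    (hκ : max (cfSmall lam lam) (cfSmall mu mu) ≤ κ) :
    (ModelImplies κ lam mu hle →
      ∀ L : AbstractLogic.{u, w}, L.IsRegular →
        ∀ V : Set (Set lam.ord.ToType), CofinalInSmall lam lam V → #V ≤ κ → L.KCompact κ V →
        ∀ W : Set (Set mu.ord.ToType), CofinalInSmall mu mu W → #W ≤ κ → L.KCompact κ W) ∧
    ((∀ D : Ultrafilter lam.ord.ToType, UniformOver lam D → Decomposable mu D) →
      ∀ L : AbstractLogic.{u, w}, L.IsRegular →
        ∀ V : Set (Set lam.ord.ToType), CofinalInSmall lam lam V → L.BoxCompact V →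
        ∀ W : Set (Set mu.ord.ToType), CofinalInSmall mu mu W → L.BoxCompact W) :=
  ⟨fun h _ hL _ hV _ hc _ hW hWκ => hL.kCompact_of_modelImplies hmu hle h hV hc hW hWκ,
    fun hD _ hL _ hV hc _ hW => hL.boxCompact_of_decomposable hmu hle hD hV hc hW⟩
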